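/- For real $\alpha,\beta>-1$ and an integer $n\ge 0$ let $P_n^{(\alpha,\beta)}(x)=\frac{(\alpha+1)_n}{n!}\sum_{k=0}^{n}\frac{(-n)_k\,(n+\alpha+\beta+1)_k}{k!\,(\alpha+1)_k}\left(\frac{1-x}{2}\right)^k$ be the Jacobi polynomial, where $(a)_k=a(a+1)\cdots(a+k-1)$ and $(a)_0=1$, and put $$\phi_n^{(\alpha,\beta)}(\mu)=\sum_{k=0}^{\lfloor n/2\rfloor}\left.\frac{d^{2k}}{dx^{2k}}P_n^{(\alpha,\beta)}(x)\right|_{x=1}\mu^k .$$ Two real polynomials $g,h$ are said to interlace strictly if all (complex) zeros of $g$ and of $h$ are real and simple, $g$ and $h$ have no common zero, between any two consecutive zeros of $g$ there is exactly one zero of $h$, and between any two consecutive zeros of $h$ there is exactly one zero of $g$. Let $-1<\alpha<0$ and $\beta>0$. Then for every integer $n\ge 2$ the polynomials $\phi_n^{(\alpha,\beta)}(\mu)$ and $\mu\,\phi_{n-2}^{(\alpha+1,\beta+1)}(\mu)$ interlace strictly, and for every integer $n\ge 1$ the polynomials $\phi_n^{(\alpha,\beta)}(\mu)$ and $\mu\,\phi_n^{(\alpha+1,\beta+1)}(\mu)$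 interlace strictly. -/

import Mathlib

open Polynomial

noncomputable section

/-- The Jacobi polynomial `P_n^{(α,β)}`, as a real polynomial: `(α+1)_n / n!` times the
terminating hypergeometric series `₂F₁(-n, n+α+β+1; α+1; (1-x)/2)`.  The terms with `k > n`
vanish because `(-n)_k = 0` for them, so the series is written as a sum over `0 ≤ k ≤ n`.
Here `(a)_k` is `(ascPochhammer ℝ k).eval a`, and `α > -1` makes all denominators positive. -/
def jacobiPoly (n : ℕ) (α β : ℝ) : ℝ[X] :=
  C ((ascPochhammer ℝ n).eval (α + 1) / (n.factorial : ℝ)) *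
    ∑ k ∈ Finset.range (n + 1),
      C ((ascPochhammer ℝ k).eval (-(n : ℝ)) * (ascPochhammer ℝ k).eval ((n : ℝ) + α + β + 1) /
          ((k.factorial : ℝ) * (ascPochhammer ℝ k).eval (α + 1))) *
        (C (1 / 2) * (1 - X)) ^ k

/-- The polynomial `φ_n^{(α,β)}(μ) = ∑_{k=0}^{⌊n/2⌋} (d^{2k}/dx^{2k} P_n^{(α,β)})(1) μ^k`. -/
def phiPoly (n : ℕ) (α β : ℝ) : ℝ[X] :=
  ∑ k ∈ Finset.range (n / 2 + 1),
    C ((derivative^[2 * k] (jacobiPoly n α β)).eval 1) * X ^ k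

/-- Between any two consecutive (real) zeros of `g` there is exactly one zero of `h`. -/
def SeparatesZeros (g h : ℝ[X]) : Prop :=
  ∀ a b : ℝ, a < b → g.IsRoot a → g.IsRoot b → (∀ c ∈ Set.Ioo a b, ¬ g.IsRoot c) →
    ∃! x : ℝ, x ∈ Set.Ioo a b ∧ h.IsRoot x

/-- All complex zeros of `g` are real and simple (in particular, `g` is not the zero polynomial). -/
def HasSimpleRealZeros (g : ℝ[X]) : Prop :=
  ∀ z : ℂ, (g.map (algebraMap ℝ ℂ)).IsRoot z →
    z.im = 0 ∧ (g.map (algebraMap ℝ ℂ)).rootMultiplicity z = 1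

/-- The zeros of the polynomials `g` and `h` interlace strictly: all zeros of `g` and `h` are real,
simple, and the two polynomials have no common zero; between two consecutive zeros of `g` there is
exactly one zero of `h`, and between two consecutive zeros of `h` exactly one zero of `g`. -/
structure StrictlyInterlace (g h : ℝ[X]) : Prop where
  simpleReal_left : HasSimpleRealZeros g
  simpleReal_right : HasSimpleRealZeros h
  distinct : ∀ x : ℝ, ¬ (g.IsRoot x ∧ h.IsRoot x)
  separates_left : SeparatesZeros g h
  separates_right : SeparatesZeros h g

end

/-! Substitute `t = (1 - x) / 2` and write `P`, `Q` for the Jacobi polynomials of degrees `n + 1`,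
`n`. For real `y` the equation `u - i y u' = P` has the polynomial solution `A + i y A'`, where `A +
y² A'' = P`; similarly `B` for `Q`. Its value at `t = 0` combines one value of each family: `A(0)`
gives φ, and `A'(0)` gives φ with raised parameters, since differentiation raises them.

If `u = c (A + i y A') + d (B + i y B')` vanishes at 0 and is nonzero, then `Re ∫ (u - i y u')
conj(u') w = ½ ∫ (|u|²)' w > 0`, because `α < 0 < β`. By orthogonality the left side is also `Re (c
conj d) ∫ Q P' w`, and `∫ Q P' w ≤ 0`. Hence `Re (c conj d) < 0` (`re_mul_conj_neg_of_eval_zero`).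
Choosing `c`, `d` to force `u(0) = 0` gives `phiPoly_mul_phiPoly_sub_pos`.

With `ψ` the raised family, that inequality says that `ψ_n` and `ψ_{n+2}` agree in sign at zeros of
`φ_{n+2}`, and `φ_n` and `φ_{n+2}` at zeros of `μ ψ_n`. Counting sign changes, an induction by steps
of two carries the interlacing along (`LinkedFamilies.exists_alternate`). -/

noncomputable section

/-! ### Integrals of polynomials against a beta weight. -/

open MeasureTheory in
theorem intervalIntegrable_rpow_mul_one_sub_rpow {a b : ℝ} (ha : -1 < a) (hb : -1 < b) :
    IntervalIntegrable (fun t : ℝ => t ^ a * (1 - t) ^ b) volume 0 1 := by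
  have hleft : ∀ {a : ℝ}, -1 < a → ∀ b : ℝ,
      IntervalIntegrable (fun t : ℝ => t ^ a * (1 - t) ^ b) volume 0 (1 / 2) := by
    intro a ha b
    refine (intervalIntegral.intervalIntegrable_rpow' ha).mul_continuousOn ?_
    intro t ht
    rw [Set.uIcc_of_le (by norm_num)] at ht
    refine ContinuousAt.continuousWithinAt ?_
    exact ContinuousAt.rpow_const (by fun_prop) (Or.inl (by linarith [ht.2]))
  refine (hleft ha b).trans ?_
  -- The reflection `t ↦ 1 - t`, with exponents swapped, handles the half near 1.
  have h := ((hleft hb a).comp_sub_left 1).symm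
  norm_num at h
  refine h.congr ?_
  intro t _
  simp [mul_comm]

/-- Integration of a polynomial against the beta weight `t ^ a * (1 - t) ^ b` on `(0, 1)`. -/
def betaFunctional (a b : ℝ) (p : ℝ[X]) : ℝ :=
  ∫ t in (0 : ℝ)..1, p.eval t * (t ^ a * (1 - t) ^ b)

theorem intervalIntegrable_eval_mul_beta {a b : ℝ} (ha : -1 < a) (hb : -1 < b) (p : ℝ[X]) :
    IntervalIntegrable (fun t : ℝ => p.eval t * (t ^ a * (1 - t) ^ b))
      MeasureTheory.volume 0 1 :=
  (intervalIntegrable_rpow_mul_one_sub_rpow ha hb).continuousOn_mul p.continuous.continuousOn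

theorem betaFunctional_add {a b : ℝ} (ha : -1 < a) (hb : -1 < b) (p q : ℝ[X]) :
    betaFunctional a b (p + q) = betaFunctional a b p + betaFunctional a b q := by
  simp only [betaFunctional, eval_add, add_mul]
  exact intervalIntegral.integral_add (intervalIntegrable_eval_mul_beta ha hb p)
    (intervalIntegrable_eval_mul_beta ha hb q)

theorem betaFunctional_C_mul (a b c : ℝ) (p : ℝ[X]) :
    betaFunctional a b (C c * p) = c * betaFunctional a b p := by
  simp only [betaFunctional, eval_mul, eval_C, mul_assoc]
  exact intervalIntegral.integral_const_mul _ _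

theorem betaFunctional_zero (a b : ℝ) : betaFunctional a b 0 = 0 := by
  simp [betaFunctional]

theorem betaFunctional_sub {a b : ℝ} (ha : -1 < a) (hb : -1 < b) (p q : ℝ[X]) :
    betaFunctional a b (p - q) = betaFunctional a b p - betaFunctional a b q := by
  have h := betaFunctional_add ha hb p (C (-1) * q)
  rw [betaFunctional_C_mul] at h
  rw [show p - q = p + C (-1) * q by simp [sub_eq_add_neg], h]
  ring

theorem betaFunctional_sum {ι : Type*} {a b : ℝ} (ha : -1 < a) (hb : -1 < b) (s : Finset ι)
    (f : ι → ℝ[X]) :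
    betaFunctional a b (∑ i ∈ s, f i) = ∑ i ∈ s, betaFunctional a b (f i) := by
  classical
  induction s using Finset.induction_on with
  | empty => simp [betaFunctional_zero]
  | insert i s hi ih => rw [Finset.sum_insert hi, Finset.sum_insert hi, betaFunctional_add ha hb, ih]

/-- The integrands agree pointwise on `(0, 1)`, so no integrability is needed. -/
theorem betaFunctional_shift (a b : ℝ) (p : ℝ[X]) :
    betaFunctional a b (X * p) = betaFunctional (a + 1) (b - 1) ((1 - X) * p) := by
  simp only [betaFunctional]
  rw [intervalIntegral.integral_of_le zero_le_one, intervalIntegral.integral_of_le zero_le_one,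
    MeasureTheory.integral_Ioc_eq_integral_Ioo, MeasureTheory.integral_Ioc_eq_integral_Ioo]
  refine MeasureTheory.setIntegral_congr_fun measurableSet_Ioo ?_
  intro t ht
  have h1 : 0 < 1 - t := by linarith [ht.2]
  simp only [eval_mul, eval_X, eval_sub, eval_one]
  rw [Real.rpow_add_one ht.1.ne', Real.rpow_sub_one h1.ne']
  field_simp

/-- Integration by parts: the boundary terms of `f * t ^ (a + 1) * (1 - t) ^ (b + 1)` vanish. -/
theorem betaFunctional_by_parts {a b : ℝ} (ha : -1 < a) (hb : -1 < b) (f : ℝ[X]) :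
    betaFunctional a b
      (X * (1 - X) * derivative f + (C (a + 1) - C (a + b + 2) * X) * f) = 0 := by
  have ha' : 0 < a + 1 := by linarith
  have hb' : 0 < b + 1 := by linarith
  have key := intervalIntegral.integral_eq_sub_of_hasDerivAt_of_le (zero_le_one (α := ℝ))
    (f := fun t : ℝ => f.eval t * (t ^ (a + 1) * (1 - t) ^ (b + 1)))
    (f' := fun t : ℝ => (X * (1 - X) * derivative f + (C (a + 1) - C (a + b + 2) * X) * f).eval t *
      (t ^ a * (1 - t) ^ b)) ?_ ?_ (intervalIntegrable_eval_mul_beta ha hb _)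
  · rw [betaFunctional, key]
    simp [Real.zero_rpow ha'.ne', Real.zero_rpow hb'.ne']
  · refine f.continuous.continuousOn.mul (Continuous.continuousOn ?_)
    exact (continuous_id.rpow_const fun _ => Or.inr ha'.le).mul
      ((continuous_const.sub continuous_id).rpow_const fun _ => Or.inr hb'.le)
  · intro t ht
    have h1 : 0 < 1 - t := by linarith [ht.2]
    have h2 := (Real.hasDerivAt_rpow_const (x := t) (p := a + 1) (Or.inl ht.1.ne'))
    have h3 := ((hasDerivAt_id t).const_sub 1).rpow_const (p := b + 1) (Or.inl h1.ne')
    refine ((f.hasDerivAt t).mul (h2.mul h3)).congr_deriv ?_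
    simp only [eval_mul, eval_X, eval_sub, eval_one, eval_add, eval_C, add_sub_cancel_right, id,
      Pi.mul_apply]
    rw [Real.rpow_add_one ht.1.ne', Real.rpow_add_one h1.ne']
    ring

theorem betaFunctional_nonneg {a b : ℝ} {p : ℝ[X]} (h : ∀ t ∈ Set.Ioo (0 : ℝ) 1, 0 ≤ p.eval t) :
    0 ≤ betaFunctional a b p := by
  rw [betaFunctional, intervalIntegral.integral_of_le zero_le_one,
    MeasureTheory.integral_Ioc_eq_integral_Ioo]
  refine MeasureTheory.setIntegral_nonneg measurableSet_Ioo fun t ht => ?_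
  have h1 : 0 < 1 - t := by linarith [ht.2]
  have h0 := ht.1
  have := h t ht
  positivity

/-- A nonzero polynomial has finitely many zeros, so the integrand is positive almost everywhere. -/
theorem betaFunctional_pos {a b : ℝ} (ha : -1 < a) (hb : -1 < b) {p : ℝ[X]} (hp : p ≠ 0)
    (h : ∀ t ∈ Set.Ioo (0 : ℝ) 1, 0 ≤ p.eval t) : 0 < betaFunctional a b p := by
  rw [betaFunctional, intervalIntegral.integral_of_le zero_le_one,
    MeasureTheory.integral_Ioc_eq_integral_Ioo,
    MeasureTheory.setIntegral_pos_iff_support_of_nonneg_ae]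
  · have hsub : Set.Ioo (0 : ℝ) 1 \ {t | p.IsRoot t} ⊆
        (Function.support fun t : ℝ => p.eval t * (t ^ a * (1 - t) ^ b)) ∩ Set.Ioo 0 1 := by
      rintro t ⟨ht, hr⟩
      have h1 : 0 < 1 - t := by linarith [ht.2]
      have h0 := ht.1
      refine ⟨mul_ne_zero hr (by positivity), ht⟩
    refine lt_of_lt_of_le ?_ (MeasureTheory.measure_mono hsub)
    rw [MeasureTheory.measure_sdiff_null ((Polynomial.finite_setOfPred_isRoot hp).measure_zero _)]
    simp
  · refine MeasureTheory.ae_restrict_of_forall_mem measurableSet_Ioo fun t ht => ?_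
    have h1 : 0 < 1 - t := by linarith [ht.2]
    have h0 := ht.1
    have := h t ht
    simp only [Pi.zero_apply]
    positivity
  · exact ((intervalIntegrable_iff_integrableOn_Ioo_of_le zero_le_one).1
      (intervalIntegrable_eval_mul_beta ha hb p))

/-- If `u 0 = 0` then `∫ (u ^ 2)' w = ∫ (u / t) ^ 2 (β t - α (1 - t)) t w / (1 - t)`. -/
theorem betaFunctional_mul_derivative {α β : ℝ} (hα : -1 < α) (hβ : 0 < β) (v : ℝ[X]) :
    2 * betaFunctional α β (X * v * derivative (X * v)) =
      betaFunctional (α + 1) (β - 1) ((C (-α) * (1 - X) + C β * X) * v ^ 2) := by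
  have ha : -1 < α + 1 := by linarith
  have hb : -1 < β - 1 := by linarith
  have h := betaFunctional_by_parts ha hb (v ^ 2)
  -- Subtracting the vanishing integral attached to `v ^ 2` cancels the terms in `v v'`.
  rw [mul_assoc X v, betaFunctional_shift, ← betaFunctional_C_mul, ← sub_zero (betaFunctional _ _ _),
    ← h, ← betaFunctional_sub ha hb]
  congr 1
  simp only [derivative_mul, derivative_X, derivative_pow, map_add, map_sub, map_neg, map_one,
    map_ofNat, Nat.cast_ofNat]
  ring

/-! ### Jacobi polynomials in the variable `t`. -/

/-- The coefficient of `t ^ k` in `P_n^{(α,β)}(1 - 2 t)`. -/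
def jacobiCoeff (n : ℕ) (α β : ℝ) (k : ℕ) : ℝ :=
  (ascPochhammer ℝ n).eval (α + 1) / (n.factorial : ℝ) *
    ((ascPochhammer ℝ k).eval (-(n : ℝ)) * (ascPochhammer ℝ k).eval ((n : ℝ) + α + β + 1) /
      ((k.factorial : ℝ) * (ascPochhammer ℝ k).eval (α + 1)))

/-- The Jacobi polynomial in the variable `t = (1 - x) / 2`. -/
def shiftedJacobi (n : ℕ) (α β : ℝ) : ℝ[X] :=
  ∑ k ∈ Finset.range (n + 1), C (jacobiCoeff n α β k) * X ^ k

theorem jacobiPoly_eq_comp (n : ℕ) (α β : ℝ) :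
    jacobiPoly n α β = (shiftedJacobi n α β).comp (C (1 / 2) * (1 - X)) := by
  simp only [jacobiPoly, shiftedJacobi, jacobiCoeff, Finset.mul_sum, comp, eval₂_finsetSum,
    eval₂_mul, eval₂_C, eval₂_pow, eval₂_X, C_mul, mul_assoc]

theorem jacobiCoeff_eq_zero {n k : ℕ} (h : n < k) (α β : ℝ) : jacobiCoeff n α β k = 0 := by
  simp [jacobiCoeff, ascPochhammer_eval_neg_coe_nat_of_lt h]

theorem coeff_shiftedJacobi (n : ℕ) (α β : ℝ) (k : ℕ) :
    (shiftedJacobi n α β).coeff k = jacobiCoeff n α β k := by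
  simp only [shiftedJacobi, finsetSum_coeff, coeff_C_mul_X_pow, Finset.sum_ite_eq,
    Finset.mem_range]
  split_ifs with h
  · rfl
  · rw [jacobiCoeff_eq_zero (by omega)]

theorem natDegree_shiftedJacobi_le (n : ℕ) (α β : ℝ) : (shiftedJacobi n α β).natDegree ≤ n := by
  refine natDegree_le_iff_coeff_eq_zero.2 fun k hk => ?_
  rw [coeff_shiftedJacobi, jacobiCoeff_eq_zero hk]

/-- Only `(-n)_k` carries a sign, namely `(-1)^k`; every other factor is positive. -/
theorem jacobiCoeff_sign {α β : ℝ} (hα : -1 < α) (hβ : 0 < β) {n k : ℕ} (hk : k ≤ n) :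
    0 < (-1) ^ k * jacobiCoeff n α β k := by
  have h1 : 0 < α + 1 := by linarith
  have h2 : 0 < (n : ℝ) + α + β + 1 := by have := n.cast_nonneg (α := ℝ); linarith
  have e : (ascPochhammer ℝ k).eval (-(n : ℝ)) = (-1) ^ k * (descPochhammer ℝ k).eval (n : ℝ) :=
    ascPochhammer_eval_neg_eq_descPochhammer ℝ (n : ℝ) k
  have h3 : 0 < (descPochhammer ℝ k).eval (n : ℝ) :=
    descPochhammer_pos (by have : (k : ℝ) ≤ n := by exact_mod_cast hk
                           linarith)
  have h4 := ascPochhammer_pos n _ h1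
  have h5 := ascPochhammer_pos k _ h1
  have h6 := ascPochhammer_pos k _ h2
  have e2 : ((-1 : ℝ) ^ k) * (-1) ^ k = 1 := by rw [← mul_pow]; simp
  have : (-1) ^ k * jacobiCoeff n α β k = ((-1 : ℝ) ^ k * (-1) ^ k) *
      ((ascPochhammer ℝ n).eval (α + 1) / (n.factorial : ℝ) *
    ((descPochhammer ℝ k).eval (n : ℝ) * (ascPochhammer ℝ k).eval ((n : ℝ) + α + β + 1) /
      ((k.factorial : ℝ) * (ascPochhammer ℝ k).eval (α + 1)))) := by
    rw [jacobiCoeff, e]; ring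
  rw [this, e2, one_mul]
  positivity

theorem jacobiCoeff_ne_zero {α β : ℝ} (hα : -1 < α) (hβ : 0 < β) {n k : ℕ} (hk : k ≤ n) :
    jacobiCoeff n α β k ≠ 0 :=
  fun h => (jacobiCoeff_sign hα hβ hk).ne' (by rw [h, mul_zero])

theorem jacobiCoeff_succ {α : ℝ} (hα : -1 < α) (n : ℕ) (β : ℝ) (k : ℕ) :
    ((k : ℝ) + 1) * (k + 1 + α) * jacobiCoeff n α β (k + 1) =
      ((k : ℝ) * (k + α + β + 1) - n * (n + α + β + 1)) * jacobiCoeff n α β k := by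
  have h1 : 0 < α + 1 := by linarith
  have h5 := (ascPochhammer_pos k _ h1).ne'
  have h6 : α + 1 + k ≠ 0 := by positivity
  have h7 : (k.factorial : ℝ) ≠ 0 := by positivity
  have h8 : (n.factorial : ℝ) ≠ 0 := by positivity
  simp only [jacobiCoeff, ascPochhammer_succ_eval, Nat.factorial_succ]
  push_cast
  field_simp
  ring

theorem ascPochhammer_succ_eval_left (k : ℕ) (x : ℝ) :
    (ascPochhammer ℝ (k + 1)).eval x = x * (ascPochhammer ℝ k).eval (x + 1) := by
  simp [ascPochhammer_succ_left]

theorem derivative_shiftedJacobi {α : ℝ} (hα : -1 < α) (n : ℕ) (β : ℝ) :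
    derivative (shiftedJacobi (n + 1) α β) =
      C (-((n : ℝ) + α + β + 2)) * shiftedJacobi n (α + 1) (β + 1) := by
  ext k
  have h1 : 0 < α + 1 := by linarith
  have h5 := (ascPochhammer_pos k (α + 1 + 1) (by linarith)).ne'
  have h7 : (k.factorial : ℝ) ≠ 0 := by positivity
  have h8 : (n.factorial : ℝ) ≠ 0 := by positivity
  rw [coeff_derivative, coeff_C_mul, coeff_shiftedJacobi, coeff_shiftedJacobi]
  simp only [jacobiCoeff, ascPochhammer_succ_eval_left, Nat.factorial_succ]
  push_cast
  rw [show -((n : ℝ) + 1) + 1 = -n by ring,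
    show (n : ℝ) + 1 + α + β + 1 = n + α + β + 2 by ring,
    show (n : ℝ) + (α + 1) + (β + 1) + 1 = n + α + β + 2 + 1 by ring]
  field_simp

/-! ### Differential equation and orthogonality. -/

/-- The Jacobi differential operator in the variable `t`. -/
def jacobiOp (α β : ℝ) (q : ℝ[X]) : ℝ[X] :=
  X * (1 - X) * derivative (derivative q) + (C (α + 1) - C (α + β + 2) * X) * derivative q

theorem jacobiOp_X_pow_succ (α β : ℝ) (j : ℕ) :
    jacobiOp α β (X ^ (j + 1)) = C (-(((j : ℝ) + 1) * (j + 1 + α + β + 1))) * X ^ (j + 1) +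
      C (((j : ℝ) + 1) * (j + 1 + α)) * X ^ j := by
  cases j with
  | zero =>
    simp only [jacobiOp, zero_add, pow_one, pow_zero, derivative_X, derivative_one, CharP.cast_eq_zero,
      map_add, map_mul, map_neg, map_one, map_ofNat]
    ring
  | succ j =>
    simp only [jacobiOp, derivative_X_pow, derivative_C_mul, Nat.add_sub_cancel]
    simp only [map_add, map_mul, map_neg, map_one, map_ofNat, Nat.cast_add, Nat.cast_one]
    ring

theorem jacobiOp_one (α β : ℝ) : jacobiOp α β 1 = 0 := by simp [jacobiOp]

theorem jacobiOp_add (α β : ℝ) (p q : ℝ[X]) :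
    jacobiOp α β (p + q) = jacobiOp α β p + jacobiOp α β q := by
  simp only [jacobiOp, derivative_add]; ring

theorem jacobiOp_C_mul (α β c : ℝ) (p : ℝ[X]) :
    jacobiOp α β (C c * p) = C c * jacobiOp α β p := by
  simp only [jacobiOp, derivative_C_mul]; ring

theorem jacobiOp_shiftedJacobi {α : ℝ} (hα : -1 < α) (n : ℕ) (β : ℝ) :
    jacobiOp α β (shiftedJacobi n α β) =
      C (-((n : ℝ) * (n + α + β + 1))) * shiftedJacobi n α β := by
  -- The coefficient recurrence makes partial sums eigenfunctions up to one top term, which vanishes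
  -- at `N = n`.
  have key : ∀ N : ℕ, jacobiOp α β (∑ k ∈ Finset.range (N + 1), C (jacobiCoeff n α β k) * X ^ k) =
      C (-((n : ℝ) * (n + α + β + 1))) * ∑ k ∈ Finset.range (N + 1), C (jacobiCoeff n α β k) * X ^ k
        - C (((N : ℝ) + 1) * (N + 1 + α) * jacobiCoeff n α β (N + 1)) * X ^ N := by
    intro N
    induction N with
    | zero =>
      have := jacobiCoeff_succ hα n β 0
      simp only [Nat.cast_zero] at this ⊢
      rw [this, zero_add, Finset.sum_range_one, jacobiOp_C_mul, pow_zero, jacobiOp_one]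
      simp
    | succ N ih =>
      rw [Finset.sum_range_succ, jacobiOp_add, ih, jacobiOp_C_mul, jacobiOp_X_pow_succ,
        jacobiCoeff_succ hα n β (N + 1)]
      simp only [map_add, map_mul, map_neg, map_one, map_sub, Nat.cast_add, Nat.cast_one]
      ring
  rw [shiftedJacobi, key, jacobiCoeff_eq_zero (Nat.lt_succ_self n)]
  simp

/-- Lagrange's identity: the difference is the by-parts expression of `p' q - p q'`. -/
theorem betaFunctional_jacobiOp_symm {α β : ℝ} (hα : -1 < α) (hβ : -1 < β) (p q : ℝ[X]) :
    betaFunctional α β (jacobiOp α β p * q) = betaFunctional α β (p * jacobiOp α β q) := by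
  have h := betaFunctional_by_parts hα hβ (derivative p * q - p * derivative q)
  rw [← sub_eq_zero, ← betaFunctional_sub hα hβ, ← h]
  congr 1
  simp only [jacobiOp, derivative_sub, derivative_mul]
  ring

/-- The operator is triangular on monomials. By symmetry each moment, times a nonzero difference of
eigenvalues, reduces to the previous moment. -/
theorem betaFunctional_shiftedJacobi_mul_X_pow {α β : ℝ} (hα : -1 < α) (hβ : 0 < β)
    {n j : ℕ} (hj : j < n) : betaFunctional α β (shiftedJacobi n α β * X ^ j) = 0 := by
  have hs : ∀ q : ℝ[X], betaFunctional α β (shiftedJacobi n α β * jacobiOp α β q) =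
      -((n : ℝ) * (n + α + β + 1)) * betaFunctional α β (shiftedJacobi n α β * q) := by
    intro q
    rw [← betaFunctional_jacobiOp_symm hα (by linarith), jacobiOp_shiftedJacobi hα, mul_assoc,
      betaFunctional_C_mul]
  induction j with
  | zero =>
    have h := hs 1
    rw [jacobiOp_one, mul_zero, betaFunctional_zero] at h
    have hn : (0 : ℝ) < n := by exact_mod_cast hj
    have : (n : ℝ) * (n + α + β + 1) ≠ 0 := by
      have : 0 < (n : ℝ) + α + β + 1 := by linarith
      positivity
    rw [pow_zero]
    simpa [this, hn.ne'] using h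
  | succ j ih =>
    have h := hs (X ^ (j + 1))
    rw [jacobiOp_X_pow_succ, mul_add, betaFunctional_add hα (by linarith), mul_left_comm,
      betaFunctional_C_mul, mul_left_comm, betaFunctional_C_mul, ih (by omega)] at h
    have hn : (j : ℝ) + 1 < n := by exact_mod_cast hj
    have hj0 : (0 : ℝ) ≤ j := by positivity
    have hpos : 0 < ((n : ℝ) - (j + 1)) * (n + (j + 1) + α + β + 1) :=
      mul_pos (by linarith) (by linarith)
    have : ((n : ℝ) - (j + 1)) * (n + (j + 1) + α + β + 1) *
        betaFunctional α β (shiftedJacobi n α β * X ^ (j + 1)) = 0 := by linear_combination h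
    exact (mul_eq_zero.1 this).resolve_left hpos.ne'

/-- `P_n` is orthogonal to all polynomials of degree less than `n`. -/
theorem betaFunctional_shiftedJacobi_mul {α β : ℝ} (hα : -1 < α) (hβ : 0 < β)
    {n : ℕ} {q : ℝ[X]} (hq : q.degree < n) :
    betaFunctional α β (shiftedJacobi n α β * q) = 0 := by
  rcases eq_or_ne q 0 with rfl | h0
  · rw [mul_zero, betaFunctional_zero]
  rw [as_sum_range' q n ((natDegree_lt_iff_degree_lt h0).2 hq), Finset.mul_sum,
    betaFunctional_sum hα (by linarith)]
  refine Finset.sum_eq_zero fun j hj => ?_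
  rw [← C_mul_X_pow_eq_monomial, mul_left_comm, betaFunctional_C_mul,
    betaFunctional_shiftedJacobi_mul_X_pow hα hβ (Finset.mem_range.1 hj), mul_zero]

/-- Modulo lower degree the derivative is `c` times the degree-`n` polynomial, and `c ≤ 0` because
leading coefficients in `t` alternate in sign. -/
theorem betaFunctional_shiftedJacobi_mul_derivative_nonpos {α β : ℝ} (hα : -1 < α) (hβ : 0 < β)
    (n : ℕ) : betaFunctional α β
      (shiftedJacobi n α β * derivative (shiftedJacobi (n + 1) α β)) ≤ 0 := by
  set p := shiftedJacobi n α β with hp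
  set q := derivative (shiftedJacobi (n + 1) α β) with hq
  set c := q.coeff n / p.coeff n with hc
  have hpn : p.coeff n ≠ 0 := by
    rw [hp, coeff_shiftedJacobi]; exact jacobiCoeff_ne_zero hα hβ le_rfl
  have hcn : c ≤ 0 := by
    have h1 := jacobiCoeff_sign hα hβ (le_refl n)
    have h2 := jacobiCoeff_sign hα hβ (le_refl (n + 1))
    have e : ((-1 : ℝ) ^ n) * (-1) ^ n = 1 := by rw [← mul_pow]; simp
    rw [hc, hq, hp, coeff_derivative, coeff_shiftedJacobi, coeff_shiftedJacobi,
      ← mul_div_mul_left _ _ (left_ne_zero_of_mul_eq_one e)]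
    refine div_nonpos_of_nonpos_of_nonneg ?_ h1.le
    rw [pow_succ] at h2
    have : (0 : ℝ) < n + 1 := by positivity
    nlinarith
  have hr : (q - C c * p).degree < n := by
    refine (degree_lt_iff_coeff_zero _ _).2 fun m hm => ?_
    rw [coeff_sub, coeff_C_mul]
    rcases hm.eq_or_lt with rfl | hm
    · rw [hc, div_mul_cancel₀ _ hpn, sub_self]
    · rw [hq, hp, coeff_derivative, coeff_shiftedJacobi, coeff_shiftedJacobi,
        jacobiCoeff_eq_zero hm, jacobiCoeff_eq_zero (by omega)]
      simp
  have e : p * q = C c * p ^ 2 + p * (q - C c * p) := by ring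
  rw [e, betaFunctional_add hα (by linarith), betaFunctional_C_mul,
    betaFunctional_shiftedJacobi_mul hα hβ hr, add_zero]
  refine mul_nonpos_of_nonpos_of_nonneg hcn (betaFunctional_nonneg fun t _ => ?_)
  rw [eval_pow]; positivity

/-! ### The resolvent and the quadratic inequality. -/

/-- The truncated resolvent `∑_{k < N} ξ ^ k p^{(2k)}` of the second derivative. -/
def evenTransform (N : ℕ) (ξ : ℝ) (p : ℝ[X]) : ℝ[X] :=
  ∑ k ∈ Finset.range N, C (ξ ^ k) * derivative^[2 * k] p

theorem derivative_evenTransform (N : ℕ) (ξ : ℝ) (p : ℝ[X]) :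
    derivative (evenTransform N ξ p) = evenTransform N ξ (derivative p) := by
  simp only [evenTransform, derivative_sum, derivative_C_mul, ← Function.iterate_succ_apply',
    ← Function.iterate_succ_apply]

theorem evenTransform_C_mul (N : ℕ) (ξ c : ℝ) (p : ℝ[X]) :
    evenTransform N ξ (C c * p) = C c * evenTransform N ξ p := by
  simp only [evenTransform, iterate_derivative_C_mul, Finset.mul_sum, mul_left_comm]

theorem evenTransform_sub {N : ℕ} (ξ : ℝ) {p : ℝ[X]} (hp : p.natDegree < 2 * N) :
    evenTransform N ξ p - C ξ * evenTransform N ξ (derivative (derivative p)) = p := by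
  have key : ∀ M : ℕ, evenTransform M ξ p - C ξ * evenTransform M ξ (derivative (derivative p)) =
      p - C (ξ ^ M) * derivative^[2 * M] p := by
    intro M
    simp only [evenTransform, ← Function.iterate_succ_apply]
    induction M with
    | zero => simp
    | succ M ih =>
      rw [Finset.sum_range_succ, Finset.sum_range_succ, mul_add, add_sub_add_comm, ih,
        show 2 * (M + 1) = (2 * M).succ.succ by omega, pow_succ, C_mul]
      ring
  rw [key, iterate_derivative_eq_zero hp, mul_zero, sub_zero]

theorem degree_derivative_lt_of_lt {p : ℝ[X]} {n : ℕ} (hp : p.degree < (n + 1 : ℕ)) :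
    (derivative p).degree < n := by
  refine (degree_lt_iff_coeff_zero _ _).2 fun m hm => ?_
  rw [coeff_derivative, (degree_lt_iff_coeff_zero _ _).1 hp _ (by omega), zero_mul]

theorem degree_evenTransform_lt {N n : ℕ} {ξ : ℝ} {p : ℝ[X]} (hp : p.degree < n) :
    (evenTransform N ξ p).degree < n := by
  rw [evenTransform, ← mem_degreeLT]
  refine Submodule.sum_mem _ fun k _ => ?_
  rw [← smul_eq_C_mul]
  refine Submodule.smul_mem _ _ (mem_degreeLT.2 ?_)
  generalize 2 * k = m
  induction m with
  | zero => exact hp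
  | succ m ih =>
    rw [Function.iterate_succ_apply']
    exact (degree_derivative_le).trans_lt ih

theorem degree_shiftedJacobi_lt (n : ℕ) (α β : ℝ) :
    (shiftedJacobi n α β).degree < (n + 1 : ℕ) :=
  (degree_le_of_natDegree_le (natDegree_shiftedJacobi_le n α β)).trans_lt
    (by exact_mod_cast Nat.lt_succ_self n)

/-- Write `u = t v`: the factor `-α (1 - t) + β t` is positive on `(0, 1)`. This is where `α < 0` is
decisive. -/
theorem betaFunctional_mul_derivative_nonneg {α β : ℝ} (hα : -1 < α) (hα0 : α < 0) (hβ : 0 < β)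
    {u : ℝ[X]} (hu : u.eval 0 = 0) :
    0 ≤ betaFunctional α β (u * derivative u) ∧
      (u ≠ 0 → 0 < betaFunctional α β (u * derivative u)) := by
  obtain ⟨v, rfl⟩ := X_dvd_iff.2 ((coeff_zero_eq_eval_zero u).trans hu)
  have h := betaFunctional_mul_derivative hα hβ v
  have hw : ∀ t ∈ Set.Ioo (0 : ℝ) 1, 0 ≤ ((C (-α) * (1 - X) + C β * X) * v ^ 2).eval t := by
    intro t ht
    have h1 : 0 < 1 - t := by linarith [ht.2]
    have h0 := ht.1
    have h2 : 0 < -α := by linarith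
    simp only [eval_mul, eval_add, eval_sub, eval_C, eval_one, eval_X, eval_pow]
    positivity
  refine ⟨by linarith [betaFunctional_nonneg (a := α + 1) (b := β - 1) hw], fun hv => ?_⟩
  have h0 : (C (-α) * (1 - X) + C β * X) * v ^ 2 ≠ 0 := by
    refine mul_ne_zero (fun h => ?_) (pow_ne_zero _ (right_ne_zero_of_mul hv))
    have := congrArg (eval 1) h
    simp at this
    exact hβ.ne' this
  linarith [betaFunctional_pos (a := α + 1) (b := β - 1) (by linarith) (by linarith) h0 hw]

/-- The real form of the following: if `u - i y u' = c P_{n+1} + d P_n` vanishes at `t = 0` and is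
not zero, then `Re (c * conj d) < 0`. -/
theorem re_mul_conj_neg_of_eval_zero {α β : ℝ} (hα : -1 < α) (hα0 : α < 0) (hβ : 0 < β)
    {n N : ℕ} (hN : n + 1 < 2 * N) (y c₁ c₂ d₁ d₂ : ℝ) {P Q A B : ℝ[X]}
    (hP : P = shiftedJacobi (n + 1) α β) (hQ : Q = shiftedJacobi n α β)
    (hA : A = evenTransform N (-y ^ 2) P) (hB : B = evenTransform N (-y ^ 2) Q)
    (hne : ¬ (c₁ = 0 ∧ c₂ = 0 ∧ d₁ = 0 ∧ d₂ = 0))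
    (h₁ : c₁ * A.eval 0 - c₂ * y * (derivative A).eval 0 + d₁ * B.eval 0 -
      d₂ * y * (derivative B).eval 0 = 0)
    (h₂ : c₁ * y * (derivative A).eval 0 + c₂ * A.eval 0 + d₁ * y * (derivative B).eval 0 +
      d₂ * B.eval 0 = 0) :
    c₁ * d₁ + c₂ * d₂ < 0 := by
  have hb : -1 < β := by linarith
  have degP : P.degree < (n + 1 + 1 : ℕ) := hP ▸ degree_shiftedJacobi_lt _ _ _
  have degQ : Q.degree < (n + 1 : ℕ) := hQ ▸ degree_shiftedJacobi_lt _ _ _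
  have ndP : P.natDegree < 2 * N := by
    rw [hP]; exact (natDegree_shiftedJacobi_le _ _ _).trans_lt hN
  have ndQ : Q.natDegree < 2 * N := by
    rw [hQ]; exact (natDegree_shiftedJacobi_le _ _ _).trans_lt (by omega)
  have degP1 := degree_derivative_lt_of_lt degP
  have degP2 := degree_derivative_lt_of_lt degP1
  have degQ1 := degree_derivative_lt_of_lt degQ
  have orthP : ∀ {q : ℝ[X]}, q.degree < (n + 1 : ℕ) → betaFunctional α β (P * q) = 0 :=
    fun hq => hP ▸ betaFunctional_shiftedJacobi_mul hα hβ hq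
  have orthQ : ∀ {q : ℝ[X]}, q.degree < n → betaFunctional α β (Q * q) = 0 :=
    fun hq => hQ ▸ betaFunctional_shiftedJacobi_mul hα hβ hq
  have eqA : A + C (y ^ 2) * derivative (derivative A) = P := by
    have := evenTransform_sub (-y ^ 2) ndP
    rw [← derivative_evenTransform, ← derivative_evenTransform, ← hA] at this
    simpa using this
  have eqB : B + C (y ^ 2) * derivative (derivative B) = Q := by
    have := evenTransform_sub (-y ^ 2) ndQ
    rw [← derivative_evenTransform, ← derivative_evenTransform, ← hB] at this
    simpa using this
  have degA2 : (derivative (derivative A)).degree < n := by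
    rw [hA, derivative_evenTransform, derivative_evenTransform]
    exact degree_evenTransform_lt degP2
  have degA3 : (derivative (derivative (derivative A))).degree < n :=
    degree_derivative_le.trans_lt degA2
  have degB1 : (derivative B).degree < n := by
    rw [hB, derivative_evenTransform]
    exact degree_evenTransform_lt degQ1
  have degB2 : (derivative (derivative B)).degree < n := degree_derivative_le.trans_lt degB1
  have eqP1 : derivative P = derivative A + C (y ^ 2) * derivative (derivative (derivative A)) := by
    rw [← eqA, derivative_add, derivative_C_mul]
  -- Once `A'` is replaced by `P' - y² A'''`, the derivative of `u` is `c P'` plus terms of this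
  -- kind, which are orthogonal to both `P` and `Q`.
  have combo : ∀ e₁ e₂ e₃ e₄ : ℝ, (C e₁ * derivative (derivative (derivative A)) +
      C e₂ * derivative (derivative A) + C e₃ * derivative B +
      C e₄ * derivative (derivative B)).degree < n := by
    intro e₁ e₂ e₃ e₄
    simp only [← smul_eq_C_mul]
    rw [← mem_degreeLT] at *
    exact Submodule.add_mem _ (Submodule.add_mem _ (Submodule.add_mem _
      (Submodule.smul_mem _ _ degA3) (Submodule.smul_mem _ _ degA2))
      (Submodule.smul_mem _ _ degB1)) (Submodule.smul_mem _ _ degB2)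
  set h := betaFunctional α β (Q * derivative P) with hh
  have hh0 : h ≤ 0 := by
    rw [hh, hP, hQ]; exact betaFunctional_shiftedJacobi_mul_derivative_nonpos hα hβ n
  have pairing : ∀ c d e₁ e₂ e₃ e₄ : ℝ, betaFunctional α β ((C c * P + C d * Q) *
      (C c * derivative P + (C e₁ * derivative (derivative (derivative A)) +
      C e₂ * derivative (derivative A) + C e₃ * derivative B +
      C e₄ * derivative (derivative B)))) = c * d * h := by
    intro c d e₁ e₂ e₃ e₄
    have hr := combo e₁ e₂ e₃ e₄
    generalize C e₁ * derivative (derivative (derivative A)) +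
      C e₂ * derivative (derivative A) + C e₃ * derivative B +
      C e₄ * derivative (derivative B) = r at hr
    have hr' : r.degree < (n + 1 : ℕ) := hr.trans (by exact_mod_cast Nat.lt_succ_self n)
    have e : (C c * P + C d * Q) * (C c * derivative P + r) =
        C (c * c) * (P * derivative P) + C c * (P * r) + C (c * d) * (Q * derivative P) +
          C d * (Q * r) := by
      simp only [C_mul]; ring
    rw [e, betaFunctional_add hα hb, betaFunctional_add hα hb, betaFunctional_add hα hb,
      betaFunctional_C_mul, betaFunctional_C_mul, betaFunctional_C_mul, betaFunctional_C_mul,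
      orthP degP1, orthP hr', orthQ hr]
    ring
  -- Real and imaginary parts of `u = c (A + i y A') + d (B + i y B')`; `ode₁` and `ode₂` are those
  -- of `u - i y u' = c P + d Q`.
  set u₁ := C c₁ * A - C (c₂ * y) * derivative A + C d₁ * B - C (d₂ * y) * derivative B with hu₁
  set u₂ := C (c₁ * y) * derivative A + C c₂ * A + C (d₁ * y) * derivative B + C d₂ * B with hu₂
  have ev₁ : u₁.eval 0 = 0 := by simpa [hu₁] using h₁
  have ev₂ : u₂.eval 0 = 0 := by simpa [hu₂] using h₂
  have ode₁ : u₁ + C y * derivative u₂ = C c₁ * P + C d₁ * Q := by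
    rw [← eqA, ← eqB]
    simp only [hu₁, hu₂, derivative_add, derivative_C_mul]
    simp only [C_mul, C_pow]
    ring
  have ode₂ : u₂ - C y * derivative u₁ = C c₂ * P + C d₂ * Q := by
    rw [← eqA, ← eqB]
    simp only [hu₁, hu₂, derivative_add, derivative_sub, derivative_C_mul]
    simp only [C_mul, C_pow]
    ring
  -- The contribution of `i y |u'|²` is purely imaginary, so the cross terms cancel.
  have sum_eq : betaFunctional α β (u₁ * derivative u₁) + betaFunctional α β (u₂ * derivative u₂) =
      (c₁ * d₁ + c₂ * d₂) * h := by
    have p₁ := pairing c₁ d₁ (-(c₁ * y ^ 2)) (-(c₂ * y)) d₁ (-(d₂ * y))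
    have p₂ := pairing c₂ d₂ (-(c₂ * y ^ 2)) (c₁ * y) d₂ (d₁ * y)
    have e₁ : C c₁ * derivative P + (C (-(c₁ * y ^ 2)) * derivative (derivative (derivative A)) +
        C (-(c₂ * y)) * derivative (derivative A) + C d₁ * derivative B +
        C (-(d₂ * y)) * derivative (derivative B)) = derivative u₁ := by
      simp only [hu₁, derivative_add, derivative_sub, derivative_C_mul]
      rw [eqP1]
      simp only [C_mul, C_neg]
      ring
    have e₂ : C c₂ * derivative P + (C (-(c₂ * y ^ 2)) * derivative (derivative (derivative A)) +
        C (c₁ * y) * derivative (derivative A) + C d₂ * derivative B +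
        C (d₁ * y) * derivative (derivative B)) = derivative u₂ := by
      simp only [hu₂, derivative_add, derivative_C_mul]
      rw [eqP1]
      simp only [C_mul, C_neg]
      ring
    clear_value u₁ u₂
    rw [e₁, ← ode₁] at p₁
    rw [e₂, ← ode₂] at p₂
    rw [← betaFunctional_add hα hb, add_mul (c₁ * d₁), ← p₁, ← p₂, ← betaFunctional_add hα hb]
    exact congrArg _ (by ring)
  clear_value u₁ u₂
  obtain ⟨n₁, s₁⟩ := betaFunctional_mul_derivative_nonneg hα hα0 hβ ev₁
  obtain ⟨n₂, s₂⟩ := betaFunctional_mul_derivative_nonneg hα hα0 hβ ev₂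
  have hsum : 0 < betaFunctional α β (u₁ * derivative u₁) +
      betaFunctional α β (u₂ * derivative u₂) := by
    by_cases z₁ : u₁ = 0
    · by_cases z₂ : u₂ = 0
      · exfalso
        have indep : ∀ c d : ℝ, C c * P + C d * Q = 0 → c = 0 ∧ d = 0 := by
          intro c d hcd
          have k1 := congrArg (fun r => coeff r (n + 1)) hcd
          have k2 := congrArg (fun r => coeff r n) hcd
          simp only [coeff_add, coeff_C_mul, hP, hQ, coeff_shiftedJacobi, coeff_zero,
            jacobiCoeff_eq_zero (Nat.lt_succ_self n), mul_zero, add_zero] at k1 k2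
          have hc := (mul_eq_zero.1 k1).resolve_right (jacobiCoeff_ne_zero hα hβ le_rfl)
          rw [hc, zero_mul, zero_add] at k2
          exact ⟨hc, (mul_eq_zero.1 k2).resolve_right (jacobiCoeff_ne_zero hα hβ le_rfl)⟩
        rw [z₁, z₂] at ode₁ ode₂
        obtain ⟨a1, a2⟩ := indep c₁ d₁ (by rw [← ode₁]; simp)
        obtain ⟨a3, a4⟩ := indep c₂ d₂ (by rw [← ode₂]; simp)
        exact hne ⟨a1, a3, a2, a4⟩
      · linarith [s₂ z₂]
    · linarith [s₁ z₁]
  by_contra! hcon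
  linarith [mul_nonpos_of_nonneg_of_nonpos hcon hh0]

theorem evenTransform_shiftedJacobi_pos {α β : ℝ} (hα : -1 < α) (hα0 : α < 0) (hβ : 0 < β)
    {n N : ℕ} (hN : n + 1 < 2 * N) {ξ : ℝ} (hξ : ξ ≤ 0) :
    0 < (evenTransform N ξ (shiftedJacobi (n + 1) α β)).eval 0 *
        (evenTransform N ξ (shiftedJacobi n α β)).eval 0 -
      ξ * ((evenTransform N ξ (derivative (shiftedJacobi (n + 1) α β))).eval 0 *
        (evenTransform N ξ (derivative (shiftedJacobi n α β))).eval 0) := by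
  obtain ⟨y, rfl⟩ : ∃ y : ℝ, ξ = -y ^ 2 := ⟨√(-ξ), by rw [Real.sq_sqrt (by linarith)]; ring⟩
  rw [← derivative_evenTransform, ← derivative_evenTransform]
  have key := fun c₁ c₂ d₁ d₂ : ℝ =>
    re_mul_conj_neg_of_eval_zero hα hα0 hβ hN y c₁ c₂ d₁ d₂ rfl rfl rfl rfl
  set A := evenTransform N (-y ^ 2) (shiftedJacobi (n + 1) α β)
  set B := evenTransform N (-y ^ 2) (shiftedJacobi n α β)
  -- If `A + i y A'` vanished at 0, then `c = 1`, `d = 0` would give `0 < 0`.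
  have hA : ¬ (A.eval 0 = 0 ∧ y * (derivative A).eval 0 = 0) := by
    rintro ⟨h1, h2⟩
    have := key 1 0 0 0 (by simp) (by simp [h1]) (by simp [h2])
    simp at this
  -- Take `c = (B + i y B')(0)` and `d = -(A + i y A')(0)`, so that `u(0) = 0`.
  have := key (B.eval 0) (y * (derivative B).eval 0) (-A.eval 0) (-(y * (derivative A).eval 0))
    (by rintro ⟨-, -, h1, h2⟩; exact hA ⟨neg_eq_zero.1 h1, neg_eq_zero.1 h2⟩) (by ring) (by ring)
  linarith

/-! ### Translation to `phiPoly`. -/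

theorem iterate_derivative_comp_half_one_sub (p : ℝ[X]) (k : ℕ) :
    derivative^[k] (p.comp (C (1 / 2) * (1 - X))) =
      C ((-1 / 2) ^ k) * (derivative^[k] p).comp (C (1 / 2) * (1 - X)) := by
  induction k with
  | zero => simp
  | succ k ih =>
    have e : derivative (C (1 / 2 : ℝ) * (1 - X)) = C (-1 / 2) := by
      rw [derivative_C_mul, derivative_sub, derivative_one, derivative_X, neg_div, C_neg]; ring
    rw [Function.iterate_succ_apply', ih, derivative_C_mul, derivative_comp, e,
      Function.iterate_succ_apply', pow_succ, C_mul]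
    ring

theorem eval_iterate_derivative_jacobiPoly (n : ℕ) (α β : ℝ) (k : ℕ) :
    (derivative^[k] (jacobiPoly n α β)).eval 1 =
      (-1 / 2) ^ k * (derivative^[k] (shiftedJacobi n α β)).eval 0 := by
  rw [jacobiPoly_eq_comp, iterate_derivative_comp_half_one_sub]
  simp [eval_comp]

/-- Each pair of derivatives in `x` costs `(-1/2)^2`, hence `x / 4`. Leaving `N` free lets
neighbouring degrees share one truncation. -/
theorem eval_phiPoly {n N : ℕ} (hN : n < 2 * N) (α β x : ℝ) :
    (phiPoly n α β).eval x = (evenTransform N (x / 4) (shiftedJacobi n α β)).eval 0 := by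
  have hsub : Finset.range (n / 2 + 1) ⊆ Finset.range N := by
    intro k; simp only [Finset.mem_range]; omega
  have e : evenTransform N (x / 4) (shiftedJacobi n α β) =
      ∑ k ∈ Finset.range (n / 2 + 1), C ((x / 4) ^ k) * derivative^[2 * k] (shiftedJacobi n α β) := by
    refine (Finset.sum_subset hsub fun k _ hk => ?_).symm
    rw [Finset.mem_range] at hk
    rw [iterate_derivative_eq_zero ((natDegree_shiftedJacobi_le n α β).trans_lt (by omega)),
      mul_zero]
  rw [e, phiPoly, eval_finsetSum, eval_finsetSum]
  refine Finset.sum_congr rfl fun k _ => ?_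
  rw [eval_iterate_derivative_jacobiPoly]
  simp only [eval_mul, eval_C, eval_pow, eval_X]
  rw [pow_mul, div_pow, div_pow, div_pow]
  norm_num
  ring

/-- The quadratic inequality `Re (F_{n+2}(i y) * conj (F_{n+1}(i y))) > 0` with `x = -y ^ 2`. -/
theorem phiPoly_mul_phiPoly_sub_pos {α β : ℝ} (hα : -1 < α) (hα0 : α < 0) (hβ : 0 < β)
    (n : ℕ) {x : ℝ} (hx : x ≤ 0) :
    0 < (phiPoly (n + 2) α β).eval x * (phiPoly (n + 1) α β).eval x -
      x * (((n + α + β + 3) * (n + α + β + 2) / 4) *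
        ((phiPoly (n + 1) (α + 1) (β + 1)).eval x * (phiPoly n (α + 1) (β + 1)).eval x)) := by
  have h := evenTransform_shiftedJacobi_pos hα hα0 hβ (n := n + 1) (N := n + 2) (by omega)
    (ξ := x / 4) (by linarith)
  rw [derivative_shiftedJacobi hα, derivative_shiftedJacobi hα, evenTransform_C_mul,
    evenTransform_C_mul, eval_C_mul, eval_C_mul, ← eval_phiPoly (by omega),
    ← eval_phiPoly (by omega), ← eval_phiPoly (by omega), ← eval_phiPoly (by omega)] at h
  push_cast at h
  convert h using 1
  ring

theorem coeff_phiPoly {n k : ℕ} (hk : k ≤ n / 2) (α β : ℝ) :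
    (phiPoly n α β).coeff k =
      (1 / 4) ^ k * ((2 * k).factorial * jacobiCoeff n α β (2 * k)) := by
  simp only [phiPoly, finsetSum_coeff, coeff_C_mul_X_pow]
  rw [Finset.sum_eq_single k (fun b _ hb => if_neg hb.symm)
    (fun h => absurd (Finset.mem_range.2 (by omega)) h), if_pos rfl,
    eval_iterate_derivative_jacobiPoly, ← coeff_zero_eq_eval_zero, coeff_iterate_derivative,
    coeff_shiftedJacobi, zero_add, Nat.descFactorial_self, pow_mul]
  norm_num

/-- Only even-indexed Jacobi coefficients enter, so the alternating sign disappears; all real zeros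
are therefore negative. -/
theorem coeff_phiPoly_pos {α β : ℝ} (hα : -1 < α) (hβ : 0 < β) {n k : ℕ} (hk : k ≤ n / 2) :
    0 < (phiPoly n α β).coeff k := by
  have h := jacobiCoeff_sign hα hβ (n := n) (k := 2 * k) (by omega)
  rw [pow_mul, neg_one_sq, one_pow, one_mul] at h
  rw [coeff_phiPoly hk]
  positivity

theorem natDegree_phiPoly {α β : ℝ} (hα : -1 < α) (hβ : 0 < β) (n : ℕ) :
    (phiPoly n α β).natDegree = n / 2 := by
  refine natDegree_eq_of_le_of_coeff_ne_zero ?_ (coeff_phiPoly_pos hα hβ le_rfl).ne'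
  refine natDegree_sum_le_of_forall_le _ _ fun k hk => ?_
  exact (natDegree_C_mul_X_pow_le _ _).trans (by have := Finset.mem_range.1 hk; omega)

theorem eval_phiPoly_pos {α β : ℝ} (hα : -1 < α) (hβ : 0 < β) (n : ℕ) {x : ℝ} (hx : 0 ≤ x) :
    0 < (phiPoly n α β).eval x := by
  rw [eval_eq_sum_range, natDegree_phiPoly hα hβ, Finset.sum_range_succ']
  have h0 := coeff_phiPoly_pos hα hβ (n := n) (k := 0) (by omega)
  have : 0 ≤ ∑ k ∈ Finset.range (n / 2), (phiPoly n α β).coeff (k + 1) * x ^ (k + 1) :=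
    Finset.sum_nonneg fun k hk => mul_nonneg
      (coeff_phiPoly_pos hα hβ (by have := Finset.mem_range.1 hk; omega)).le (by positivity)
  rw [pow_zero, mul_one]
  linarith

/-! ### Alternating zeros and strict interlacing. -/

theorem neg_one_pow_mul_prod_sub_pos {r : ℕ → ℝ} {y : ℝ} {j N : ℕ} (hj : j ≤ N)
    (h₁ : ∀ i < j, y < r i) (h₂ : ∀ i < N, j ≤ i → r i < y) :
    0 < (-1) ^ j * ∏ i ∈ Finset.range N, (y - r i) := by
  rw [← Finset.prod_range_mul_prod_Ico _ hj, ← mul_assoc]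
  refine mul_pos ?_ (Finset.prod_pos fun i hi => ?_)
  · have e : (-1 : ℝ) ^ j = ∏ _i ∈ Finset.range j, (-1 : ℝ) := by simp
    rw [e, ← Finset.prod_mul_distrib]
    exact Finset.prod_pos fun i hi => by linarith [h₁ i (Finset.mem_range.1 hi)]
  · rw [Finset.mem_Ico] at hi
    linarith [h₂ i hi.2 hi.1]

/-- `f` is a positive multiple of `∏ i < m, (X - a i)`. -/
def IsPosProd (f : ℝ[X]) (m : ℕ) (a : ℕ → ℝ) : Prop :=
  ∃ c : ℝ, 0 < c ∧ f = C c * ∏ i ∈ Finset.range m, (X - C (a i))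

/-- `a 0 > b 0 > a 1 > b 1 > ⋯`, with `k` terms `a i` and `m` terms `b i`. -/
structure Alternate (a b : ℕ → ℝ) (k m : ℕ) : Prop where
  lt : ∀ i < m, b i < a i
  succ_lt : ∀ i, i + 1 < k → a (i + 1) < b i

namespace IsPosProd

variable {f : ℝ[X]} {m : ℕ} {a : ℕ → ℝ}

theorem isRoot_iff (h : IsPosProd f m a) {x : ℝ} : f.IsRoot x ↔ ∃ i < m, x = a i := by
  obtain ⟨c, hc, rfl⟩ := h
  simp [IsRoot, eval_prod, Finset.prod_eq_zero_iff, hc.ne', sub_eq_zero]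

theorem sign (h : IsPosProd f m a) {y : ℝ} {j : ℕ} (hj : j ≤ m)
    (h₁ : ∀ i < j, y < a i) (h₂ : ∀ i < m, j ≤ i → a i < y) : 0 < (-1) ^ j * f.eval y := by
  obtain ⟨c, hc, rfl⟩ := h
  have := mul_pos hc (neg_one_pow_mul_prod_sub_pos hj h₁ h₂)
  simp only [eval_mul, eval_C, eval_prod, eval_sub, eval_X]
  linarith

theorem hasSimpleRealZeros (h : IsPosProd f m a) (ha : ∀ i j, i < j → j < m → a j < a i) :
    HasSimpleRealZeros f := by
  obtain ⟨c, hc, rfl⟩ := h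
  have hc' : algebraMap ℝ ℂ c ≠ 0 := by simpa using hc.ne'
  have hinj : Set.InjOn (fun i => algebraMap ℝ ℂ (a i)) (Finset.range m) := by
    intro i hi j hj hij
    simp only [Finset.coe_range, Set.mem_Iio] at hi hj
    have hij : a i = a j := by simpa using hij
    rcases lt_trichotomy i j with h | h | h
    · exact absurd hij (ha i j h hj).ne'
    · exact h
    · exact absurd hij (ha j i h hi).ne
  have e : (C c * ∏ i ∈ Finset.range m, (X - C (a i))).map (algebraMap ℝ ℂ) =
      C (algebraMap ℝ ℂ c) *
        ∏ z ∈ (Finset.range m).image (fun i => algebraMap ℝ ℂ (a i)), (X - C z) := by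
    rw [Finset.prod_image hinj]
    simp only [Polynomial.map_mul, Polynomial.map_prod, Polynomial.map_sub, map_X, map_C]
  intro z hz
  rw [e] at hz ⊢
  have hne : C (algebraMap ℝ ℂ c) *
      ∏ z ∈ (Finset.range m).image (fun i => algebraMap ℝ ℂ (a i)), (X - C z) ≠ 0 :=
    mul_ne_zero (C_ne_zero.2 hc') (Finset.prod_ne_zero_iff.2 fun z _ => X_sub_C_ne_zero z)
  have hmem := (mem_roots hne).2 hz
  rw [← count_roots]
  rw [roots_C_mul _ hc', roots_prod_X_sub_C] at hmem ⊢
  refine ⟨?_, Multiset.count_eq_one_of_mem (Finset.nodup _) hmem⟩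
  obtain ⟨i, -, rfl⟩ := Finset.mem_image.1 (Finset.mem_def.2 hmem)
  simp

end IsPosProd

namespace Alternate

variable {a b : ℕ → ℝ} {k m : ℕ}

theorem left_anti (h : Alternate a b k m) (hk : k ≤ m + 1) (i j : ℕ) (hij : i < j) (hj : j < k) :
    a j < a i := by
  induction j, hij using Nat.le_induction with
  | base => exact (h.succ_lt i hj).trans (h.lt i (by omega))
  | succ j hij ih => exact ((h.succ_lt j hj).trans (h.lt j (by omega))).trans (ih (by omega))

theorem right_anti (h : Alternate a b k m) (hm : m ≤ k) (i j : ℕ) (hij : i < j) (hj : j < m) :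
    b j < b i := by
  induction j, hij using Nat.le_induction with
  | base => exact (h.lt _ hj).trans (h.succ_lt i (by omega))
  | succ j hij ih => exact ((h.lt _ hj).trans (h.succ_lt j (by omega))).trans (ih (by omega))

theorem right_lt_left (h : Alternate a b k m) (hk : k ≤ m + 1) (hm : m ≤ k) {i l : ℕ}
    (hil : i ≤ l) (hl : l < m) : b l < a i := by
  rcases hil.eq_or_lt with rfl | hil
  · exact h.lt _ hl
  · exact (h.lt _ hl).trans (h.left_anti hk _ _ hil (by omega))

theorem left_lt_right (h : Alternate a b k m) (hk : k ≤ m + 1) {i l : ℕ}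
    (hil : l < i) (hi : i < k) : a i < b l := by
  rcases (Nat.succ_le_of_lt hil).eq_or_lt with rfl | hil'
  · exact h.succ_lt _ hi
  · exact (h.left_anti hk _ _ hil' hi).trans (h.succ_lt _ (by omega))

/-- Both `k = m` and `k = m + 1` are needed: the former for `φ_{n+2}` against `μ ψ_n`, the latter
for `φ_n` against `μ ψ_n`. -/
theorem strictlyInterlace {f g : ℝ[X]} (h : Alternate a b k m) (hk : k ≤ m + 1) (hm : m ≤ k)
    (hf : IsPosProd f k a) (hg : IsPosProd g m b) : StrictlyInterlace g f where
  simpleReal_left := hg.hasSimpleRealZeros (h.right_anti hm)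
  simpleReal_right := hf.hasSimpleRealZeros (h.left_anti hk)
  distinct := by
    rintro x ⟨hx, hy⟩
    obtain ⟨l, hl, rfl⟩ := hg.isRoot_iff.1 hx
    obtain ⟨i, hi, e⟩ := hf.isRoot_iff.1 hy
    rcases le_or_gt i l with hil | hil
    · exact (h.right_lt_left hk hm hil hl).ne e
    · exact (h.left_lt_right hk hil hi).ne' e
  separates_left := by
    intro x y hxy hx hy hno
    obtain ⟨j, hj, rfl⟩ := hg.isRoot_iff.1 hx
    obtain ⟨i, hi, rfl⟩ := hg.isRoot_iff.1 hy
    have hij : i < j := by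
      by_contra! hji
      rcases hji.eq_or_lt with rfl | hji
      · exact lt_irrefl _ hxy
      · exact lt_asymm hxy (h.right_anti hm _ _ hji hi)
    have hj' : j = i + 1 := by
      by_contra hne
      exact hno (b (i + 1)) ⟨h.right_anti hm _ _ (by omega) hj,
        h.right_anti hm _ _ (by omega) (by omega)⟩ (hg.isRoot_iff.2 ⟨i + 1, by omega, rfl⟩)
    subst hj'
    refine ⟨a (i + 1), ⟨⟨h.lt _ hj, h.succ_lt _ (by omega)⟩,
      hf.isRoot_iff.2 ⟨_, by omega, rfl⟩⟩, ?_⟩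
    rintro z ⟨⟨hz1, hz2⟩, hz⟩
    obtain ⟨l, hl, rfl⟩ := hf.isRoot_iff.1 hz
    have h1 : l ≤ i + 1 := by
      by_contra! hc
      exact lt_asymm hz1 (h.left_lt_right hk hc hl)
    have h2 : i < l := by
      by_contra! hc
      exact lt_asymm hz2 (h.right_lt_left hk hm hc hi)
    rw [show l = i + 1 by omega]
  separates_right := by
    intro x y hxy hx hy hno
    obtain ⟨j, hj, rfl⟩ := hf.isRoot_iff.1 hx
    obtain ⟨i, hi, rfl⟩ := hf.isRoot_iff.1 hy
    have hij : i < j := by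
      by_contra! hji
      rcases hji.eq_or_lt with rfl | hji
      · exact lt_irrefl _ hxy
      · exact lt_asymm hxy (h.left_anti hk _ _ hji hi)
    have hj' : j = i + 1 := by
      by_contra hne
      exact hno (a (i + 1)) ⟨h.left_anti hk _ _ (by omega) hj,
        h.left_anti hk _ _ (by omega) (by omega)⟩ (hf.isRoot_iff.2 ⟨i + 1, by omega, rfl⟩)
    subst hj'
    refine ⟨b i, ⟨⟨h.succ_lt _ hj, h.lt _ (by omega)⟩, hg.isRoot_iff.2 ⟨_, by omega, rfl⟩⟩, ?_⟩
    rintro z ⟨⟨hz1, hz2⟩, hz⟩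
    obtain ⟨l, hl, rfl⟩ := hg.isRoot_iff.1 hz
    have h1 : l < i + 1 := by
      by_contra! hc
      exact lt_asymm hz1 (h.right_lt_left hk hm hc hl)
    have h2 : i ≤ l := by
      by_contra! hc
      exact lt_asymm hz2 (h.left_lt_right hk hc hi)
    rw [show l = i by omega]

end Alternate

/-! ### Zeros from sign changes. -/

theorem exists_isRoot_of_mul_neg {g : ℝ[X]} {x y : ℝ} (hxy : x < y)
    (h : g.eval x * g.eval y < 0) : ∃ z ∈ Set.Ioo x y, g.IsRoot z := by
  have hc : ContinuousOn (fun t => g.eval t) (Set.Icc x y) := g.continuous.continuousOn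
  rcases mul_neg_iff.1 h with ⟨h1, h2⟩ | ⟨h1, h2⟩
  · obtain ⟨z, hz, e⟩ := intermediate_value_Ioo' hxy.le hc ⟨h2, h1⟩
    exact ⟨z, hz, e⟩
  · obtain ⟨z, hz, e⟩ := intermediate_value_Ioo hxy.le hc ⟨h1, h2⟩
    exact ⟨z, hz, e⟩

theorem exists_lt_neg_one_pow_mul_eval_pos {g : ℝ[X]} (hg : 0 < g.leadingCoeff) (x : ℝ) :
    ∃ y < x, 0 < (-1) ^ g.natDegree * g.eval y := by
  have hne : g ≠ 0 := leadingCoeff_ne_zero.1 hg.ne'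
  set q : ℝ[X] := C ((-1) ^ g.natDegree) * g.comp (-X) with hq
  have hq' : ∀ t, q.eval t = (-1) ^ g.natDegree * g.eval (-t) := by simp [hq, eval_comp]
  rcases Nat.eq_zero_or_pos g.natDegree with h0 | h0
  · refine ⟨x - 1, by linarith, ?_⟩
    rw [eq_C_of_natDegree_eq_zero h0] at hg ⊢
    simpa using hg
  · have hdeg : q.natDegree = g.natDegree := by
      rw [hq, natDegree_C_mul (pow_ne_zero _ (by norm_num)), natDegree_comp]; simp
    have hlead : q.leadingCoeff = g.leadingCoeff := by
      rw [hq, leadingCoeff_mul, leadingCoeff_C, leadingCoeff_comp (by simp), leadingCoeff_neg,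
        leadingCoeff_X, mul_left_comm, ← mul_pow]
      simp
    have ht := q.tendsto_atTop_of_leadingCoeff_nonneg (natDegree_pos_iff_degree_pos.1 (hdeg ▸ h0))
      (hlead ▸ hg.le)
    obtain ⟨t, h1, h2⟩ := ((ht.eventually_gt_atTop 0).and
      (Filter.eventually_gt_atTop (-x))).exists
    exact ⟨-t, by linarith, by rwa [← hq']⟩

theorem isPosProd_of_roots {g : ℝ[X]} {b : ℕ → ℝ} (hg : 0 < g.leadingCoeff)
    (hb : ∀ i j, i < j → j < g.natDegree → b j < b i) (hr : ∀ i < g.natDegree, g.IsRoot (b i)) :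
    IsPosProd g g.natDegree b := by
  refine ⟨g.leadingCoeff, hg, ?_⟩
  have hmonic : (∏ i ∈ Finset.range g.natDegree, (X - C (b i))).Monic :=
    monic_prod_of_monic _ _ fun i _ => monic_X_sub_C _
  refine eq_leadingCoeff_mul_of_monic_of_dvd_of_natDegree_le hmonic ?_ ?_
  · refine Finset.prod_dvd_of_coprime ?_ fun i hi =>
      dvd_iff_isRoot.2 (hr i (Finset.mem_range.1 hi))
    intro i hi j hj hij
    simp only [Finset.coe_range, Set.mem_Iio] at hi hj
    refine isCoprime_X_sub_C_of_isUnit_sub (isUnit_iff_ne_zero.2 (sub_ne_zero.2 ?_))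
    rcases lt_or_gt_of_ne hij with h | h
    · exact (hb i j h hj).ne'
    · exact (hb j i h hi).ne
  · rw [natDegree_prod_of_monic _ _ fun i _ => monic_X_sub_C _]
    simp

/-- If `g` has degree `m` and alternates in sign at the `m` points `a 0 > a 1 > ⋯`, then it has
`m` zeros `b i`, one below each `a i`. -/
theorem exists_alternate_of_sign {g : ℝ[X]} {m : ℕ} {a : ℕ → ℝ} (hd : g.natDegree = m)
    (hg : 0 < g.leadingCoeff) (ha : ∀ i, i + 1 < m → a (i + 1) < a i)
    (hs : ∀ i < m, 0 < (-1) ^ i * g.eval (a i)) :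
    ∃ b, IsPosProd g m b ∧ Alternate a b m m := by
  have hroot : ∀ i, ∃ z, i < m → g.IsRoot z ∧ z < a i ∧ (i + 1 < m → a (i + 1) < z) := by
    intro i
    by_cases hi : i < m
    swap
    · exact ⟨0, fun h => absurd h hi⟩
    have e : ((-1 : ℝ) ^ i) * (-1) ^ i = 1 := by rw [← mul_pow]; simp
    have h1 := hs i hi
    -- Below the lowest point, the sign near `-∞` supplies the last sign change.
    obtain ⟨y, hy, hy', hy''⟩ : ∃ y < a i, 0 < (-1) ^ (i + 1) * g.eval y ∧
        (i + 1 < m → y = a (i + 1)) := by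
      by_cases hi' : i + 1 < m
      · exact ⟨a (i + 1), ha i hi', hs _ hi', fun _ => rfl⟩
      · obtain ⟨y, hy, h⟩ := exists_lt_neg_one_pow_mul_eval_pos hg (a i)
        rw [hd, show m = i + 1 by omega] at h
        exact ⟨y, hy, h, fun h => absurd h hi'⟩
    have hneg : g.eval y * g.eval (a i) < 0 := by
      have h2 := mul_pos hy' h1
      have : (-1) ^ (i + 1) * g.eval y * ((-1) ^ i * g.eval (a i)) =
          -(((-1 : ℝ) ^ i) * (-1) ^ i) * (g.eval y * g.eval (a i)) := by ring
      rw [this, e] at h2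
      linarith
    obtain ⟨z, hz, hr⟩ := exists_isRoot_of_mul_neg hy hneg
    exact ⟨z, fun _ => ⟨hr, hz.2, fun h => hy'' h ▸ hz.1⟩⟩
  choose b hb using hroot
  have halt : Alternate a b m m :=
    ⟨fun i hi => (hb i hi).2.1, fun i hi => (hb i (by omega)).2.2 hi⟩
  subst hd
  exact ⟨b, isPosProd_of_roots hg (halt.right_anti le_rfl) fun i hi => (hb i hi).1, halt⟩

/-! ### The interlacing induction. -/

/-- Two families of polynomials linked by the inequalities `φ_{n+2} φ_{n+1} > x κ_n ψ_{n+1} ψ_n`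
on `(-∞, 0]`. -/
structure LinkedFamilies (φ ψ : ℕ → ℝ[X]) (κ : ℕ → ℝ) : Prop where
  natDegree_left : ∀ n, (φ n).natDegree = n / 2
  natDegree_right : ∀ n, (ψ n).natDegree = n / 2
  lead_left : ∀ n, 0 < (φ n).leadingCoeff
  lead_right : ∀ n, 0 < (ψ n).leadingCoeff
  eval_left : ∀ n x, 0 ≤ x → 0 < (φ n).eval x
  eval_right : ∀ n x, 0 ≤ x → 0 < (ψ n).eval x
  pos : ∀ n, 0 < κ n
  ineq : ∀ n x, x ≤ 0 → 0 < (φ (n + 2)).eval x * (φ (n + 1)).eval x -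
    x * (κ n * ((ψ (n + 1)).eval x * (ψ n).eval x))

namespace LinkedFamilies

variable {φ ψ : ℕ → ℝ[X]} {κ : ℕ → ℝ}

/-- At such a zero, inequalities `n` and `n + 1` lose their φ-terms. As `x < 0`, both `ψ n` and `ψ
(n + 2)` share the sign of `ψ (n + 1)`. -/
theorem right_mul_right_pos (h : LinkedFamilies φ ψ κ) {n : ℕ} {x : ℝ}
    (hx : (φ (n + 2)).IsRoot x) : 0 < (ψ n).eval x * (ψ (n + 2)).eval x := by
  have hx0 : x < 0 := by
    by_contra! h0
    exact (h.eval_left _ x h0).ne' hx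
  have h1 := h.ineq n x hx0.le
  have h2 := h.ineq (n + 1) x hx0.le
  rw [IsRoot.def] at hx
  rw [hx] at h1 h2
  have k1 := h.pos n
  have k2 := h.pos (n + 1)
  have p1 : 0 < (ψ (n + 1)).eval x * (ψ n).eval x :=
    pos_of_mul_pos_right (a := -x * κ n) (by linarith) (by nlinarith)
  have p2 : 0 < (ψ (n + 2)).eval x * (ψ (n + 1)).eval x :=
    pos_of_mul_pos_right (a := -x * κ (n + 1)) (by linarith) (by nlinarith)
  have p := mul_pos p1 p2
  have : 0 < (ψ (n + 1)).eval x ^ 2 * ((ψ n).eval x * (ψ (n + 2)).eval x) := by linarith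
  exact pos_of_mul_pos_right this (sq_nonneg _)

/-- At a zero of `ψ n`, inequalities `n - 1` and `n` compare both values with `φ (n + 1)`; at the
zero 0 both are positive anyway. -/
theorem left_mul_left_pos (h : LinkedFamilies φ ψ κ) {n : ℕ} {x : ℝ}
    (hx : (X * ψ n).IsRoot x) : 0 < (φ n).eval x * (φ (n + 2)).eval x := by
  rcases le_or_gt 0 x with h0 | h0
  · exact mul_pos (h.eval_left _ _ h0) (h.eval_left _ _ h0)
  have hx' : (ψ n).eval x = 0 := by
    simpa [IsRoot, h0.ne] using hx
  -- `ψ 0` is a nonzero constant, so index `n - 1` exists.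
  obtain ⟨n, rfl⟩ : ∃ l, n = l + 1 := by
    refine Nat.exists_eq_succ_of_ne_zero ?_
    rintro rfl
    have hd := h.natDegree_right 0
    rw [eq_C_of_natDegree_eq_zero hd, eval_C] at hx'
    have := h.eval_right 0 0 le_rfl
    rw [← coeff_zero_eq_eval_zero, hx'] at this
    exact lt_irrefl _ this
  have h1 := h.ineq n x h0.le
  have h2 := h.ineq (n + 1) x h0.le
  rw [hx'] at h1 h2
  have p : 0 < (φ (n + 2)).eval x ^ 2 * ((φ (n + 1)).eval x * (φ (n + 3)).eval x) := by
    have := mul_pos h1 h2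
    ring_nf at this ⊢
    linarith
  exact pos_of_mul_pos_right p (sq_nonneg _)

theorem alternate_of_sign (h : LinkedFamilies φ ψ κ) {n : ℕ} {b : ℕ → ℝ}
    (hφ : IsPosProd (φ n) (n / 2) b) (hb : ∀ i, i + 1 < n / 2 → b (i + 1) < b i)
    (hs : ∀ i < n / 2, 0 < (-1) ^ i * (ψ n).eval (b i)) :
    ∃ a b, IsPosProd (X * ψ n) (n / 2 + 1) a ∧ IsPosProd (φ n) (n / 2) b ∧
      Alternate a b (n / 2 + 1) (n / 2) := by
  obtain ⟨e, he, halt⟩ := exists_alternate_of_sign (h.natDegree_right n) (h.lead_right n) hb hs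
  -- The zero 0 of the factor `X` comes first, above all zeros of `φ n`.
  refine ⟨fun i => Nat.casesOn i 0 e, b, ?_, hφ, ?_, ?_⟩
  · obtain ⟨c, hc, hψ⟩ := he
    refine ⟨c, hc, ?_⟩
    rw [Finset.prod_range_succ', hψ]
    change _ = C c * (_ * (X - C 0))
    rw [C_0, sub_zero]
    ring
  · intro i hi
    cases i with
    | zero =>
      by_contra! hc
      exact (h.eval_left n _ hc).ne' (hφ.isRoot_iff.2 ⟨0, hi, rfl⟩)
    | succ i => exact halt.succ_lt i hi
  · intro i hi
    exact halt.lt i (by omega)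

/-- At the zeros of `X * ψ n`, `φ (n + 2)` inherits the alternating signs of `φ n`. -/
theorem alternate_succ (h : LinkedFamilies φ ψ κ) {n : ℕ} {a b : ℕ → ℝ}
    (hψ : IsPosProd (X * ψ n) (n / 2 + 1) a) (hφ : IsPosProd (φ n) (n / 2) b)
    (hab : Alternate a b (n / 2 + 1) (n / 2)) :
    ∃ b, IsPosProd (φ (n + 2)) (n / 2 + 1) b ∧ Alternate a b (n / 2 + 1) (n / 2 + 1) := by
  refine exists_alternate_of_sign (by rw [h.natDegree_left]; omega) (h.lead_left _)
    (fun i hi => hab.left_anti le_rfl _ _ (Nat.lt_succ_self i) hi) fun i hi => ?_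
  have h1 := hφ.sign (y := a i) (j := i) (by omega)
    (fun l hl => hab.left_lt_right le_rfl hl hi)
    (fun l hl hil => hab.right_lt_left le_rfl (by omega) hil hl)
  have h2 := h.left_mul_left_pos (hψ.isRoot_iff.2 ⟨i, hi, rfl⟩)
  have h3 := mul_pos h1 h2
  refine pos_of_mul_pos_right (a := (φ n).eval (a i) ^ 2) ?_ (sq_nonneg _)
  linarith

theorem exists_alternate (h : LinkedFamilies φ ψ κ) (n : ℕ) :
    ∃ a b, IsPosProd (X * ψ n) (n / 2 + 1) a ∧ IsPosProd (φ n) (n / 2) b ∧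
      Alternate a b (n / 2 + 1) (n / 2) := by
  induction n using Nat.twoStepInduction with
  | zero =>
    -- Degree zero: the points `a` are arbitrary and the sign conditions vacuous.
    obtain ⟨b, hb, -⟩ := exists_alternate_of_sign (a := 0) (h.natDegree_left 0) (h.lead_left 0)
      (fun i hi => by omega) (fun i hi => by omega)
    exact h.alternate_of_sign hb (fun i hi => by omega) (fun i hi => by omega)
  | one =>
    obtain ⟨b, hb, -⟩ := exists_alternate_of_sign (a := 0) (h.natDegree_left 1) (h.lead_left 1)
      (fun i hi => by omega) (fun i hi => by omega)
    exact h.alternate_of_sign hb (fun i hi => by omega) (fun i hi => by omega)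
  | more n ih _ =>
    obtain ⟨a, b₀, hψ, hφ, hab⟩ := ih
    obtain ⟨b, hb, halt⟩ := h.alternate_succ hψ hφ hab
    have hd : (n + 2) / 2 = n / 2 + 1 := by omega
    rw [← hd] at hb halt hψ
    refine h.alternate_of_sign hb
      (fun i hi => halt.right_anti le_rfl _ _ (Nat.lt_succ_self i) hi) fun i hi => ?_
    -- Exactly `a 0, …, a i` lie above `b i`; the negative factor `X` absorbs one of the `i + 1`
    -- signs.
    have h1 := hψ.sign (y := b i) (j := i + 1) (by omega)
      (fun l hl => halt.right_lt_left (by omega) le_rfl (by omega) hi)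
      (fun l hl hil => halt.left_lt_right (by omega) hil hl)
    have hneg : b i < 0 := by
      by_contra! hc
      exact (h.eval_left _ _ hc).ne' (hb.isRoot_iff.2 ⟨i, hi, rfl⟩)
    rw [eval_mul, eval_X] at h1
    have h2 := h.right_mul_right_pos (hb.isRoot_iff.2 ⟨i, hi, rfl⟩)
    have h3 := mul_pos h1 h2
    refine pos_of_mul_pos_right (a := -b i * (ψ n).eval (b i) ^ 2) ?_
      (mul_nonneg (by linarith) (sq_nonneg _))
    rw [pow_succ] at h3
    linarith

theorem strictlyInterlace_same (h : LinkedFamilies φ ψ κ) (n : ℕ) :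
    StrictlyInterlace (φ n) (X * ψ n) := by
  obtain ⟨a, b, hψ, hφ, hab⟩ := h.exists_alternate n
  exact hab.strictlyInterlace le_rfl (by omega) hψ hφ

theorem strictlyInterlace_add_two (h : LinkedFamilies φ ψ κ) (n : ℕ) :
    StrictlyInterlace (φ (n + 2)) (X * ψ n) := by
  obtain ⟨a, b, hψ, hφ, hab⟩ := h.exists_alternate n
  obtain ⟨b, hb, halt⟩ := h.alternate_succ hψ hφ hab
  exact halt.strictlyInterlace (by omega) le_rfl hψ hb

end LinkedFamilies

/-! ### Application to the Jacobi families. -/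

theorem leadingCoeff_phiPoly_pos {α β : ℝ} (hα : -1 < α) (hβ : 0 < β) (n : ℕ) :
    0 < (phiPoly n α β).leadingCoeff := by
  rw [leadingCoeff, natDegree_phiPoly hα hβ]
  exact coeff_phiPoly_pos hα hβ le_rfl

theorem linkedFamilies_phiPoly {α β : ℝ} (hα : -1 < α) (hα0 : α < 0) (hβ : 0 < β) :
    LinkedFamilies (fun n => phiPoly n α β) (fun n => phiPoly n (α + 1) (β + 1))
      (fun n => ((n : ℝ) + α + β + 3) * (n + α + β + 2) / 4) := by
  have hα' : -1 < α + 1 := by linarith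
  have hβ' : 0 < β + 1 := by linarith
  refine ⟨natDegree_phiPoly hα hβ, natDegree_phiPoly hα' hβ', leadingCoeff_phiPoly_pos hα hβ,
    leadingCoeff_phiPoly_pos hα' hβ', fun n x => eval_phiPoly_pos hα hβ n,
    fun n x => eval_phiPoly_pos hα' hβ' n, fun n => ?_,
    fun n x => phiPoly_mul_phiPoly_sub_pos hα hα0 hβ n⟩
  have hn := n.cast_nonneg (α := ℝ)
  have h1 : 0 < (n : ℝ) + α + β + 3 := by linarith
  have h2 : 0 < (n : ℝ) + α + β + 2 := by linarith
  positivity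

end

theorem corollary9 (α β : ℝ) (hα : -1 < α) (hα0 : α < 0) (hβ : 0 < β) :
    (∀ n : ℕ, 2 ≤ n →
      StrictlyInterlace (phiPoly n α β) (X * phiPoly (n - 2) (α + 1) (β + 1))) ∧
    (∀ n : ℕ, 1 ≤ n →
      StrictlyInterlace (phiPoly n α β) (X * phiPoly n (α + 1) (β + 1))) := by
  have h := linkedFamilies_phiPoly hα hα0 hβ
  refine ⟨fun n hn => ?_, fun n _ => h.strictlyInterlace_same n⟩
  obtain ⟨n, rfl⟩ := Nat.exists_eq_add_of_le' hn
  exact h.strictlyInterlace_add_two n
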